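/- **Setting.** Let $\mathbb T=\mathbb R/2\pi\mathbb Z$, and for $x\in\mathbb T$ let $|x|$ be the distance from a representative of $x$ to the nearest multiple of $2\pi$; distances and diameters in $\mathbb T$ are taken in the metric $|x-y|$. A *low pass filter* is an even function $H:\mathbb R\to[0,1]$ with $H(t)=H(0)>0$ for $|t|\le 1/2$, $H(t)\le H(0)$ for all $t$, and $H(t)=0$ for $|t|\ge 1$. For an integer $n\ge1$ and a sequence $(a_\ell)$ put $$\hbar_n=\Big(\sum_{|\ell|<n}H(|\ell|/n)\Big)^{-1},\quad \sigma_n(a)(x)=\hbar_n\sum_{|\ell|<n}H(|\ell|/n)\,a_\ell e^{i\ell x},\quad \Phi_n(x)=\hbar_n\sum_{|\ell|<n}H(|\ell|/n)e^{i\ell x},$$ and for $F:\mathbb R\to\mathbb C$, $R>0$, $$\mathcal T_{n,R}(F)(t;x)=\hbar_n\sum_{|\ell|<n}H(|\ell|/n)\,F(t-\ell/R)e^{i\ell x}.$$ For $S\ge2$ a *localization constant of order $S$* is a number $L\ge1$ with $|\Phi_n(x)|\le L/\max(1,(n|x|)^S)$ for all $n\ge1$, $x\in\mathbb T$. A real random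 variable $X$ is in $\mathcal G(V)$, $V>0$, if $\mathbb E X=0$ and $\log\mathbb E e^{tX}\le t^2V^2/2$ for all $t\in\mathbb R$; a complex one is in $\mathcal G(V)$ if its real and imaginary parts are. **Theorem 3.3.** Let $H$ be a low pass filter. (a) If $H$ is infinitely differentiable, then for every real $S\ge2$ it has a localization constant of order $S$. (b) There are constants $C_1\ge1$, $C_2,C_3>0$, depending only on $H$, such that the following two statements hold. *Noise estimate.* If $V>0$, $0<\delta<1$, $n\ge C_1$, and $\epsilon_\ell$, $|\ell|<n$, are independent complex random variables in $\mathcal G(V)$, then $$\mathrm{Prob}\Big(\max_{x\in\mathbb T}|\sigma_n(\epsilon)(x)|\ge C_2V\sqrt{\log(C_3n/\delta)/n}\Big)\le\delta.$$ *Separation.* Let $0<\delta<1$, $t^*\in\mathbb R$, $R,\Delta,\alpha,V>0$, $K\ge1$, $n=\lfloor R\Delta\rfloor$, let $S\ge 2$ and let $L$ be a localization constant of order $S$. On $[t^*-\Delta,t^*+\Delta]$ let $A_1,\dots,A_K$ be continuous and complex valued and let $\phi_1,\dots,\phi_K$ be continuously differentiable and real valued, with $A_j(t^*)\ne0$ and,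 for $|u|\le\Delta$, $$|A_j(t^*+u)-A_j(t^*)|\le\alpha|u||A_j(t^*)|,\qquad |\phi_j'(t^*+u)-\phi_j'(t^*)|\le\alpha|u||\phi_j'(t^*)|.$$ Let $F(t)=\sum_{j=1}^KA_j(t)e^{i\phi_j(t)}+\epsilon(t)$, where $\epsilon(t^*-\ell/R)$, $|\ell|<n$, are independent complex random variables in $\mathcal G(V)$. Write $$\mathbf M=\sum_j|A_j(t^*)|,\quad \mathfrak m=\min_j|A_j(t^*)|,\quad B=\max_j|\phi_j'(t^*)|,\quad \lambda_j=\phi_j'(t^*)/R\in\mathbb T,$$ $$\eta^*=\min_{\ell\ne k}|\lambda_\ell-\lambda_k|\ (=\infty\text{ if }K=1),\qquad C=(16\mathbf ML/\mathfrak m)^{1/S},$$ and assume $$n\ge C_1,\quad C_2V\sqrt{\log(C_3n/\delta)/n}\le\mathfrak m/16,\quad n\ge 4C/\eta^*,\quad \alpha\mathbf M(B\Delta+1)\Delta\le\mathfrak m/4.$$ Then there is an event of probability greater than $1-\delta$ on which the set $\mathbb G=\{x\in\mathbb T:|\mathcal T_{n,R}(F)(t^*;x)|\ge3\mathfrak m/4\}$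 is a disjoint union of exactly $K$ sets $\mathbb G_1,\dots,\mathbb G_K$ such that 1. $\mathrm{diam}(\mathbb G_\ell)\le2C/n$ for every $\ell$; 2. $\mathrm{dist}(\mathbb G_\ell,\mathbb G_k)\ge\eta^*/2$ for $\ell\ne k$; 3. $\{x\in\mathbb T:|x-\lambda_\ell|\le1/(4n)\}\subseteq\mathbb G_\ell$ for every $\ell$; 4. for every $\ell$, $|\mathcal T_{n,R}(F)(t^*;\cdot)|$ attains its maximum over $\mathbb G_\ell$, and every point $\hat\lambda_\ell\in\mathbb G_\ell$ where it does satisfies $|\hat\lambda_\ell-\lambda_\ell|\le2C/n$. -/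

import Mathlib

open scoped ENNReal NNReal

noncomputable section

namespace SSO

open MeasureTheory ProbabilityTheory Real

/-- The quotient group `ℝ / 2πℤ` with its quotient metric: `‖x‖` is the distance of a
representative of `x` to the nearest multiple of `2π`. -/
abbrev Torus : Type := AddCircle (2 * π)

/-- A low pass filter `H : ℝ → [0, 1]`: even, equal to a positive constant (its largest value)
for `|t| ≤ 1/2`, and zero for `|t| ≥ 1`. -/
structure IsLowPass (H : ℝ → ℝ) : Prop where
  mem_Icc : ∀ t, H t ∈ Set.Icc (0 : ℝ) 1
  even : ∀ t, H (-t) = H t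
  const : ∀ t, |t| ≤ 1 / 2 → H t = H 0
  pos : 0 < H 0
  le_const : ∀ t, H t ≤ H 0
  zero : ∀ t, 1 ≤ |t| → H t = 0

/-- The normalizing factor: the inverse of `∑_{|ℓ| < n} H(|ℓ| / n)`. -/
def hbar (H : ℝ → ℝ) (n : ℕ) : ℝ :=
  (∑ ℓ ∈ Finset.Ioo (-(n : ℤ)) (n : ℤ), H (|(ℓ : ℝ)| / n))⁻¹

/-- `σ_n(a)(x) = ħ_n ∑_{|ℓ| < n} H(|ℓ| / n) a_ℓ e^{iℓx}` for a sequence `a`; on `ℝ / 2πℤ` the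
Fourier monomial `fourier ℓ x` is `e^{iℓx}`. -/
def sigma (H : ℝ → ℝ) (n : ℕ) (a : ℤ → ℂ) (x : Torus) : ℂ :=
  (hbar H n : ℂ) * ∑ ℓ ∈ Finset.Ioo (-(n : ℤ)) (n : ℤ),
    (H (|(ℓ : ℝ)| / n) : ℂ) * a ℓ * fourier ℓ x

/-- The localized kernel `Φ_n(x) = ħ_n ∑_{|ℓ| < n} H(|ℓ| / n) e^{iℓx}`. -/
def kernel (H : ℝ → ℝ) (n : ℕ) (x : Torus) : ℂ :=
  sigma H n (fun _ => 1) x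

/-- `L ≥ 1` is a localization constant of order `S` for the kernels built from `H`. -/
def IsLocConst (H : ℝ → ℝ) (S L : ℝ) : Prop :=
  1 ≤ L ∧ ∀ n : ℕ, 0 < n → ∀ x : Torus, ‖kernel H n x‖ ≤ L / max 1 ((n * ‖x‖) ^ S)

/-- The signal separation operator
`𝒯_{n,R}(F)(t; x) = ħ_n ∑_{|ℓ| < n} H(|ℓ| / n) F(t - ℓ / R) e^{iℓx}`. -/
def sso (H : ℝ → ℝ) (n : ℕ) (R : ℝ) (F : ℝ → ℂ) (t : ℝ) (x : Torus) : ℂ :=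
  sigma H n (fun ℓ => F (t - ℓ / R)) x

section Noise

variable {Ω : Type*} [MeasurableSpace Ω]

/-- A real random variable in `𝒢(V)`: mean zero and `log 𝔼 exp(tX) ≤ t²V²/2` for all real `t`,
all these exponential moments being finite. -/
def IsSubgaussian (X : Ω → ℝ) (V : ℝ) (P : Measure Ω) : Prop :=
  ∫ ω, X ω ∂P = 0 ∧ HasSubgaussianMGF X (V ^ 2).toNNReal P

/-- A complex random variable in `𝒢(V)`: real and imaginary parts are in `𝒢(V)`. -/
def IsComplexSubgaussian (Z : Ω → ℂ) (V : ℝ) (P : Measure Ω) : Prop :=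
  Measurable Z ∧ IsSubgaussian (fun ω => (Z ω).re) V P ∧ IsSubgaussian (fun ω => (Z ω).im) V P

/-- The noise samples `e_ℓ`, `|ℓ| < n`, are independent and belong to `𝒢(V)`. -/
structure IsNoise (P : Measure Ω) (V : ℝ) (n : ℕ) (e : ℤ → Ω → ℂ) : Prop where
  subgaussian : ∀ ℓ : Set.Ioo (-(n : ℤ)) (n : ℤ), IsComplexSubgaussian (e ℓ) V P
  indep : iIndepFun (fun ℓ : Set.Ioo (-(n : ℤ)) (n : ℤ) => e ℓ) P

end Noise

/-- The level `C₂ V √(log(C₃ n / δ) / n)` of the noise in `σ_n`. -/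
def noiseLevel (C₂ C₃ V δ : ℝ) (n : ℕ) : ℝ :=
  C₂ * V * √(log (C₃ * n / δ) / n)

section Signal

variable {K : ℕ} (A : Fin K → ℝ → ℂ) (φ : Fin K → ℝ → ℝ) (t : ℝ)

/-- The ground truth `f(t) = ∑_j A_j(t) exp(i φ_j(t))`. -/
def signal : ℂ := ∑ j, A j t * Complex.exp (Complex.I * φ j t)

/-- `𝐌(t) = ∑_j |A_j(t)|`. -/
def sumAmp : ℝ := ∑ j, ‖A j t‖

/-- `𝔪(t) = min_j |A_j(t) exp(i φ_j(t))|`. -/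
def minAmp : ℝ := ⨅ j, ‖A j t * Complex.exp (Complex.I * φ j t)‖

/-- `B(t) = max_j |φ_j'(t)|`. -/
def maxFreq : ℝ := ⨆ j, |deriv (φ j) t|

/-- `λ_j = φ_j'(t) / R`, as a point of `ℝ / 2πℤ`. -/
def freq (R : ℝ) (j : Fin K) : Torus := ((deriv (φ j) t / R : ℝ) : Torus)

/-- `η^* = min_{ℓ ≠ k} |λ_ℓ - λ_k|`, distances taken in `ℝ / 2πℤ`; it is `∞` if `K = 1`. -/
def minSep (R : ℝ) : ℝ≥0∞ :=
  ⨅ (ℓ : Fin K) (k : Fin K) (_ : ℓ ≠ k), edist (freq φ t R ℓ) (freq φ t R k)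

/-- `C = (16 𝐌 L / 𝔪)^{1/S}`. -/
def thresholdC (S L : ℝ) : ℝ := (16 * sumAmp A t * L / minAmp A φ t) ^ (1 / S)

/-- On `[t - Δ, t + Δ]` the `A_j` are continuous, the `φ_j` are continuously differentiable,
and for `|u| ≤ Δ`, `|A_j(t + u) - A_j(t)| ≤ α |u| |A_j(t)|` and
`|φ_j'(t + u) - φ_j'(t)| ≤ α |u| |φ_j'(t)|` (derivatives at the end points are one-sided). -/
structure SlowlyVarying (α Δ : ℝ) : Prop where
  continuousOn : ∀ j, ContinuousOn (A j) (Set.Icc (t - Δ) (t + Δ))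
  contDiffOn : ∀ j, ContDiffOn ℝ 1 (φ j) (Set.Icc (t - Δ) (t + Δ))
  amp : ∀ j, ∀ u : ℝ, |u| ≤ Δ → ‖A j (t + u) - A j t‖ ≤ α * |u| * ‖A j t‖
  freq : ∀ j, ∀ u : ℝ, |u| ≤ Δ →
    |derivWithin (φ j) (Set.Icc (t - Δ) (t + Δ)) (t + u) - deriv (φ j) t|
      ≤ α * |u| * |deriv (φ j) t|

end Signal

/-- The level set `{x : |g(x)| ≥ c}`. -/
def levelSet (g : Torus → ℂ) (c : ℝ) : Set Torus := {x | c ≤ ‖g x‖}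

/-- The conclusion for one realization: the level set `{|g| ≥ c}` is a disjoint union of `K`
pieces of diameter at most `2C/n`, at mutual distances at least `η/2`, the `ℓ`-th of which
contains the `1/(4n)`-neighbourhood of `lam ℓ`; moreover `|g|` attains its maximum on every piece,
and every point where it does so is within `2C/n` of `lam ℓ`. -/
def Separates {K : ℕ} (g : Torus → ℂ) (c C : ℝ) (n : ℕ) (η : ℝ≥0∞) (lam : Fin K → Torus) :
    Prop :=
  ∃ G : Fin K → Set Torus,
    levelSet g c = ⋃ ℓ, G ℓ ∧
    Pairwise (fun ℓ k => Disjoint (G ℓ) (G k)) ∧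
    (∀ ℓ, Metric.diam (G ℓ) ≤ 2 * C / n) ∧
    (∀ ℓ k, ℓ ≠ k → ∀ x ∈ G ℓ, ∀ y ∈ G k, η / 2 ≤ edist x y) ∧
    (∀ ℓ, {x | ‖x - lam ℓ‖ ≤ 1 / (4 * n)} ⊆ G ℓ) ∧
    (∀ ℓ, ∃ x ∈ G ℓ, IsMaxOn (fun y => ‖g y‖) (G ℓ) x) ∧
    ∀ ℓ, ∀ x ∈ G ℓ, IsMaxOn (fun y => ‖g y‖) (G ℓ) x → ‖x - lam ℓ‖ ≤ 2 * C / n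

end SSO

end

noncomputable section

namespace SSO

open MeasureTheory ProbabilityTheory Real

/-! The weights `weight H n ℓ` form a probability vector. Since `H` equals its maximum on half of
its range, each weight is at most `1/n` and the first absolute moment is at most `n/2`. This makes
the constants 1, 16, 20 serve every `H`.

Localization (`IsLowPass.exists_isLocConst`): multiplying the kernel by `(e^{-ix} - 1)^k` takes `k`
differences of the samples of `H`. These are `O(n^{-k})` at `O(n)` places, and the normalization is
`O(1/n)`, so `(n|x|)^k |Φ_n(x)|` stays bounded.

Noise (`IsNoise.measureReal_exists_le_norm_sigma_lt`): at a fixed point `σ_n` of the noise is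
subgaussian with variance proxy `O(V²/n)`. A trigonometric polynomial of degree below `n` has at
least half of its maximum on a grid of `O(n²)` points, and a union bound costs only a logarithm.

Separation (`separates_of_noise_le`) is deterministic once the noise is small. Freezing amplitudes
and linearizing phases turns the operator into `∑ c_j Φ_n(x - λ_j)` with error at most `m/8`, to
which noise adds `m/16`. By `separates_of_norm_sub_le`, the level `3m/4` is then unreachable farther
than `C/n` from all centres and exceeded within `1/(4n)` of each. -/

instance : Fact (0 < 2 * π) := ⟨two_pi_pos⟩

/-! ### Moments of the filter weights -/

/-- The normalized weights `ħ_n H(|ℓ| / n)`. -/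
def weight (H : ℝ → ℝ) (n : ℕ) (ℓ : ℤ) : ℝ := hbar H n * H (|(ℓ : ℝ)| / n)

lemma sigma_eq_sum_weight (H : ℝ → ℝ) (n : ℕ) (a : ℤ → ℂ) (x : Torus) :
    sigma H n a x = ∑ ℓ ∈ Finset.Ioo (-(n : ℤ)) (n : ℤ), (weight H n ℓ : ℂ) * a ℓ * fourier ℓ x := by
  simp only [sigma, weight, Finset.mul_sum, Complex.ofReal_mul, mul_assoc]

namespace IsLowPass

variable {H : ℝ → ℝ} (hH : IsLowPass H) {n : ℕ} (hn : 0 < n)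
include hH

lemma nonneg (t : ℝ) : 0 ≤ H t := (hH.mem_Icc t).1

lemma comp_abs_div (ℓ : ℤ) : H (|(ℓ : ℝ)| / n) = H ((ℓ : ℝ) / n) := by
  rcases abs_choice (ℓ : ℝ) with h | h <;> rw [h]
  rw [neg_div, hH.even]

include hn

lemma mul_le_sum : H 0 * n ≤ ∑ ℓ ∈ Finset.Ioo (-(n : ℤ)) (n : ℤ), H (|(ℓ : ℝ)| / n) := by
  have hn' : (0 : ℝ) < n := by exact_mod_cast hn
  -- For either parity of `n` this block has `2⌊n/2⌋ + 1 ≥ n` integers, all in the range where `H`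
  -- is constant.
  calc H 0 * n ≤ ∑ ℓ ∈ Finset.Icc (-((n : ℤ) / 2)) ((n : ℤ) / 2), H 0 := by
        rw [Finset.sum_const, Int.card_Icc, nsmul_eq_mul, mul_comm]
        gcongr
        · exact hH.pos.le
        · omega
    _ = ∑ ℓ ∈ Finset.Icc (-((n : ℤ) / 2)) ((n : ℤ) / 2), H (|(ℓ : ℝ)| / n) := by
        refine Finset.sum_congr rfl fun ℓ hℓ => (hH.const _ ?_).symm
        rw [Finset.mem_Icc] at hℓ
        have : |ℓ| * 2 ≤ n := by rcases abs_cases ℓ with h | h <;> omega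
        have : |(ℓ : ℝ)| * 2 ≤ n := by exact_mod_cast this
        rw [abs_div, abs_abs, Nat.abs_cast, div_le_div_iff₀ hn' two_pos]
        linarith
    _ ≤ _ := by
        refine Finset.sum_le_sum_of_subset_of_nonneg (fun ℓ hℓ => ?_) fun _ _ _ => hH.nonneg _
        rw [Finset.mem_Icc] at hℓ
        rw [Finset.mem_Ioo]
        omega

lemma sum_pos : 0 < ∑ ℓ ∈ Finset.Ioo (-(n : ℤ)) (n : ℤ), H (|(ℓ : ℝ)| / n) :=
  (mul_pos hH.pos (by exact_mod_cast hn)).trans_le (hH.mul_le_sum hn)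

lemma hbar_pos : 0 < hbar H n := inv_pos.2 (hH.sum_pos hn)

lemma hbar_le : hbar H n ≤ (H 0 * n)⁻¹ :=
  inv_anti₀ (mul_pos hH.pos (by exact_mod_cast hn)) (hH.mul_le_sum hn)

lemma weight_nonneg (ℓ : ℤ) : 0 ≤ weight H n ℓ :=
  mul_nonneg (hH.hbar_pos hn).le (hH.nonneg _)

lemma sum_weight : ∑ ℓ ∈ Finset.Ioo (-(n : ℤ)) (n : ℤ), weight H n ℓ = 1 := by
  simp only [weight, ← Finset.mul_sum]
  exact inv_mul_cancel₀ (hH.sum_pos hn).ne'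

/-- `H 0` cancels between the maximum of `H` and the lower bound for the normalizing sum. -/
lemma weight_le (ℓ : ℤ) : weight H n ℓ ≤ 1 / n := by
  have h0 := hH.pos
  have hn' : (0 : ℝ) < n := by exact_mod_cast hn
  calc weight H n ℓ ≤ (H 0 * n)⁻¹ * H 0 :=
        mul_le_mul (hH.hbar_le hn) (hH.le_const _) (hH.nonneg _) (by positivity)
    _ = 1 / n := by field_simp

lemma sum_weight_sq_le : ∑ ℓ ∈ Finset.Ioo (-(n : ℤ)) (n : ℤ), weight H n ℓ ^ 2 ≤ 1 / n := by
  calc _ ≤ ∑ ℓ ∈ Finset.Ioo (-(n : ℤ)) (n : ℤ), 1 / n * weight H n ℓ :=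
        Finset.sum_le_sum fun ℓ _ => by
          rw [sq]; exact mul_le_mul_of_nonneg_right (hH.weight_le hn ℓ) (hH.weight_nonneg hn ℓ)
    _ = 1 / n := by rw [← Finset.mul_sum, hH.sum_weight hn, mul_one]

omit hH in
lemma sum_abs_sub_half_nonpos :
    ∑ ℓ ∈ Finset.Ioo (-(n : ℤ)) (n : ℤ), (|(ℓ : ℝ)| - n / 2) ≤ 0 := by
  have key : ∀ m : ℕ, ∑ ℓ ∈ Finset.Ioo (-((m : ℤ) + 1)) ((m : ℤ) + 1), |(ℓ : ℝ)| = m * (m + 1) := by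
    intro m
    induction m with
    | zero => simp [show Finset.Ioo (-(1 : ℤ)) 1 = {0} from rfl]
    | succ m ih =>
      have : Finset.Ioo (-(((m + 1 : ℕ) : ℤ) + 1)) (((m + 1 : ℕ) : ℤ) + 1) =
          insert (-((m : ℤ) + 1)) (insert ((m : ℤ) + 1)
            (Finset.Ioo (-((m : ℤ) + 1)) ((m : ℤ) + 1))) := by
        ext ℓ
        simp only [Finset.mem_Ioo, Finset.mem_insert]
        push_cast
        omega
      rw [this, Finset.sum_insert, Finset.sum_insert, ih]
      · push_cast
        rw [abs_neg, abs_of_nonneg (by positivity)]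
        ring
      · simp
      · simp only [Finset.mem_Ioo, Finset.mem_insert]
        omega
  obtain ⟨m, rfl⟩ : ∃ m, n = m + 1 := ⟨n - 1, by omega⟩
  rw [Finset.sum_sub_distrib, Finset.sum_const, Int.card_Ioo]
  have h1 := key m
  have h2 : ((((m + 1 : ℕ) : ℤ) - -((m + 1 : ℕ) : ℤ) - 1).toNat : ℝ) = 2 * m + 1 := by
    have : (((m + 1 : ℕ) : ℤ) - -((m + 1 : ℕ) : ℤ) - 1).toNat = 2 * m + 1 := by omega
    rw [this]; push_cast; ring
  rw [nsmul_eq_mul, h2]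
  push_cast at h1 ⊢
  rw [h1]
  have : (0 : ℝ) ≤ m := by positivity
  nlinarith

/-- Comparison with flat weights: `H` equals `H 0` where `|ℓ| - n/2` is negative and is at most `H
0` where it is positive, so flattening only increases the centred moment. The factor `1/2` is needed
for the final error budget. -/
lemma sum_weight_mul_abs_le :
    ∑ ℓ ∈ Finset.Ioo (-(n : ℤ)) (n : ℤ), weight H n ℓ * |(ℓ : ℝ)| ≤ n / 2 := by
  have hn' : (0 : ℝ) < n := by exact_mod_cast hn
  have hb := hH.hbar_pos hn
  have h : ∑ ℓ ∈ Finset.Ioo (-(n : ℤ)) (n : ℤ), weight H n ℓ * (|(ℓ : ℝ)| - n / 2) ≤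
      ∑ ℓ ∈ Finset.Ioo (-(n : ℤ)) (n : ℤ), hbar H n * H 0 * (|(ℓ : ℝ)| - n / 2) := by
    refine Finset.sum_le_sum fun ℓ _ => ?_
    rw [weight]
    rcases le_total |(ℓ : ℝ)| (n / 2) with h | h
    · rw [hH.const (|(ℓ : ℝ)| / n)]
      rw [abs_div, abs_abs, Nat.abs_cast, div_le_div_iff₀ hn' two_pos]
      linarith
    · exact mul_le_mul_of_nonneg_right (mul_le_mul_of_nonneg_left (hH.le_const _) hb.le)
        (sub_nonneg.2 h)
  have h2 : ∑ ℓ ∈ Finset.Ioo (-(n : ℤ)) (n : ℤ), hbar H n * H 0 * (|(ℓ : ℝ)| - n / 2) ≤ 0 := by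
    rw [← Finset.mul_sum]
    exact mul_nonpos_of_nonneg_of_nonpos (mul_nonneg hb.le hH.pos.le) (sum_abs_sub_half_nonpos hn)
  have h3 : ∑ ℓ ∈ Finset.Ioo (-(n : ℤ)) (n : ℤ), weight H n ℓ * (|(ℓ : ℝ)| - n / 2) =
      ∑ ℓ ∈ Finset.Ioo (-(n : ℤ)) (n : ℤ), weight H n ℓ * |(ℓ : ℝ)| - n / 2 := by
    simp only [mul_sub, Finset.sum_sub_distrib, ← Finset.sum_mul, hH.sum_weight hn, one_mul]
  linarith

lemma norm_sigma_le (a : ℤ → ℂ) (x : Torus) :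
    ‖sigma H n a x‖ ≤ ∑ ℓ ∈ Finset.Ioo (-(n : ℤ)) (n : ℤ), weight H n ℓ * ‖a ℓ‖ := by
  rw [sigma_eq_sum_weight]
  refine (norm_sum_le _ _).trans (Finset.sum_le_sum fun ℓ _ => ?_)
  rw [norm_mul, norm_mul, Complex.norm_real, Real.norm_of_nonneg (hH.weight_nonneg hn ℓ),
    fourier_apply, Circle.norm_coe, mul_one]

end IsLowPass

/-! ### Linearity of `sigma` and characters of the circle -/

lemma sigma_add (H : ℝ → ℝ) (n : ℕ) (a b : ℤ → ℂ) (x : Torus) :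
    sigma H n (fun ℓ => a ℓ + b ℓ) x = sigma H n a x + sigma H n b x := by
  simp only [sigma, mul_add, add_mul, Finset.sum_add_distrib]

lemma sigma_sub (H : ℝ → ℝ) (n : ℕ) (a b : ℤ → ℂ) (x : Torus) :
    sigma H n (fun ℓ => a ℓ - b ℓ) x = sigma H n a x - sigma H n b x := by
  simp only [sigma, mul_sub, sub_mul, Finset.sum_sub_distrib]

lemma continuous_sigma (H : ℝ → ℝ) (n : ℕ) (a : ℤ → ℂ) : Continuous (sigma H n a) := by
  unfold sigma
  fun_prop

lemma fourier_coe_eq_exp (ℓ : ℤ) (y : ℝ) :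
    fourier ℓ (y : Torus) = Complex.exp (Complex.I * ((ℓ * y : ℝ) : ℂ)) := by
  rw [fourier_coe_apply]
  congr 1
  have : (π : ℂ) ≠ 0 := by exact_mod_cast pi_ne_zero
  push_cast
  field_simp

lemma exists_coe_eq_abs_eq_norm (x : Torus) : ∃ y : ℝ, (y : Torus) = x ∧ |y| = ‖x‖ ∧ |y| ≤ π := by
  induction x using QuotientAddGroup.induction_on with
  | H z =>
    have h := AddCircle.norm_eq (2 * π) (x := z)
    refine ⟨z - round ((2 * π)⁻¹ * z) * (2 * π), ?_, h.symm, ?_⟩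
    · rw [← zsmul_eq_mul, AddCircle.coe_sub, AddCircle.coe_zsmul, AddCircle.coe_period, smul_zero,
        sub_zero]
    · rw [← h]
      have := AddCircle.norm_le_half_period (2 * π) (x := (z : Torus)) two_pi_pos.ne'
      rwa [abs_of_pos two_pi_pos, mul_div_cancel_left₀ _ two_ne_zero] at this

/-- Jordan's inequality for `|e^{iy} - 1| = 2 |sin (y/2)|`, with the representative `|y| ≤ π`. -/
lemma two_div_pi_mul_norm_le (x : Torus) : 2 / π * ‖x‖ ≤ ‖fourier 1 x - 1‖ := by
  obtain ⟨y, rfl, hy, hyπ⟩ := exists_coe_eq_abs_eq_norm x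
  rw [fourier_coe_eq_exp, Complex.norm_exp_I_mul_ofReal_sub_one, ← hy]
  have h := mul_abs_le_abs_sin (x := y / 2) (by rw [abs_div, abs_two]; linarith)
  rw [abs_div, abs_two] at h
  rw [norm_mul, Real.norm_two, Real.norm_eq_abs]
  simp only [Int.cast_one, one_mul]
  linarith

lemma norm_fourier_sub_le (ℓ : ℤ) (x y : Torus) :
    ‖fourier ℓ x - fourier ℓ y‖ ≤ |(ℓ : ℝ)| * ‖x - y‖ := by
  obtain ⟨z, hz, hz', -⟩ := exists_coe_eq_abs_eq_norm (x - y)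
  have hx : fourier ℓ x = fourier ℓ (z : Torus) * fourier ℓ y := by
    rw [← sub_add_cancel x y, ← hz]
    simp only [fourier_apply, smul_add, AddCircle.toCircle_add, Circle.coe_mul]
  have : fourier ℓ x - fourier ℓ y = (fourier ℓ (z : Torus) - 1) * fourier ℓ y := by
    rw [hx]; ring
  rw [this, norm_mul, fourier_apply (x := y), Circle.norm_coe, mul_one, fourier_coe_eq_exp, ← hz',
    ← abs_mul]
  exact norm_exp_I_mul_ofReal_sub_one_le

/-! ### Finite differences and localization of the kernel -/

lemma fwdDiff_iter_succ_apply {M G : Type*} [AddCommMonoid M] [AddCommGroup G] (h : M) (k : ℕ)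
    (f : M → G) (y : M) :
    (fwdDiff h)^[k + 1] f y = (fwdDiff h)^[k] f (y + h) - (fwdDiff h)^[k] f y := by
  rw [Function.iterate_succ_apply']
  rfl

lemma abs_fwdDiff_iter_le {h : ℝ} (hh : 0 ≤ h) (k : ℕ) : ∀ {f : ℝ → ℝ} {M : ℝ},
    ContDiff ℝ (⊤ : ℕ∞) f → (∀ y, |iteratedDeriv k f y| ≤ M) →
    ∀ y, |(fwdDiff h)^[k] f y| ≤ h ^ k * M := by
  induction k with
  | zero => intro f M _ hM y; simpa using hM y
  | succ k ih =>
    intro f M hf hM y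
    have hf' : ContDiff ℝ (⊤ : ℕ∞) (fun y => f (y + h)) := hf.comp (contDiff_id.add contDiff_const)
    have hd : Differentiable ℝ (iteratedDeriv k f) :=
      hf.differentiable_iteratedDeriv k (by exact_mod_cast WithTop.coe_lt_top k)
    -- The innermost difference is peeled off: its `k`-th derivative is a difference of
    -- `iteratedDeriv k f`, at most `h * M` by the mean value inequality.
    rw [Function.iterate_succ_apply, pow_succ, mul_assoc]
    refine ih (hf'.sub hf) (fun z => ?_) y
    have hk : ((k : ℕ∞) : WithTop ℕ∞) ≤ ((⊤ : ℕ∞) : WithTop ℕ∞) := by exact_mod_cast le_top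
    have : iteratedDeriv k (fwdDiff h f) z = iteratedDeriv k f (z + h) - iteratedDeriv k f z := by
      have h1 := iteratedDeriv_fun_sub (n := k) (x := z) (hf'.of_le hk).contDiffAt
        (hf.of_le hk).contDiffAt
      have h2 := congrFun (iteratedDeriv_comp_add_const k f h) z
      rw [← h2, ← h1]
      rfl
    have hmv := convex_univ.norm_image_sub_le_of_norm_deriv_le (f := iteratedDeriv k f) (C := M)
      (fun w _ => hd w) (fun w _ => by rw [← iteratedDeriv_succ]; exact hM w)
      (Set.mem_univ z) (Set.mem_univ (z + h))
    rw [add_sub_cancel_left, Real.norm_eq_abs, Real.norm_of_nonneg hh] at hmv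
    change |iteratedDeriv k (fwdDiff h f) z| ≤ h * M
    rw [this]
    linarith

lemma fwdDiff_iter_comp_mul (f : ℝ → ℝ) (h : ℝ) (k : ℕ) (ℓ : ℤ) :
    (fwdDiff 1)^[k] (fun m : ℤ => f (m * h)) ℓ = (fwdDiff h)^[k] f (ℓ * h) := by
  induction k generalizing ℓ with
  | zero => rfl
  | succ k ih =>
    rw [fwdDiff_iter_succ_apply, fwdDiff_iter_succ_apply, ih, ih]
    push_cast
    rw [add_mul, one_mul]

/-- A forward difference looks one step to the right, so the support grows only to the left. -/
lemma fwdDiff_iter_eq_zero {g : ℤ → ℝ} {n : ℤ} (hg : ∀ ℓ ∉ Finset.Ioo (-n) n, g ℓ = 0) (k : ℕ) :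
    ∀ ℓ ∉ Finset.Ioo (-n - k) n, (fwdDiff 1)^[k] g ℓ = 0 := by
  induction k with
  | zero => simpa using hg
  | succ k ih =>
    intro ℓ hℓ
    rw [Finset.mem_Ioo] at hℓ
    rw [fwdDiff_iter_succ_apply, ih, ih, sub_zero]
    all_goals
      rw [Finset.mem_Ioo]
      push_cast at hℓ
      omega

/-- Summation by parts for trigonometric sums with finitely many terms. -/
lemma tsum_fwdDiff_mul_fourier {g : ℤ → ℝ} {s : Finset ℤ} (hg : ∀ ℓ ∉ s, g ℓ = 0) (x : Torus) :
    ∑' ℓ, ((fwdDiff 1 g ℓ : ℝ) : ℂ) * fourier ℓ x =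
      (fourier (-1) x - 1) * ∑' ℓ, (g ℓ : ℂ) * fourier ℓ x := by
  have hs : Summable fun ℓ => (g ℓ : ℂ) * fourier ℓ x :=
    summable_of_ne_finset_zero (s := s) fun ℓ hℓ => by
      rw [hg ℓ hℓ, Complex.ofReal_zero, zero_mul]
  have hs' : Summable fun ℓ => (g (ℓ + 1) : ℂ) * fourier (ℓ + 1) x :=
    (summable_of_ne_finset_zero (s := s.image (· - 1)) fun ℓ hℓ => by
      rw [hg (ℓ + 1) fun h => hℓ (Finset.mem_image.2 ⟨ℓ + 1, h, by ring⟩)]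
      simp only [Complex.ofReal_zero, zero_mul])
  -- Summing over all of `ℤ` makes the shift free of boundary terms.
  have he : ∑' ℓ, (g (ℓ + 1) : ℂ) * fourier (ℓ + 1) x = ∑' ℓ, (g ℓ : ℂ) * fourier ℓ x :=
    (Equiv.addRight (1 : ℤ)).tsum_eq fun ℓ => (g ℓ : ℂ) * fourier ℓ x
  calc ∑' ℓ, ((fwdDiff 1 g ℓ : ℝ) : ℂ) * fourier ℓ x
      = ∑' ℓ, (fourier (-1) x * ((g (ℓ + 1) : ℂ) * fourier (ℓ + 1) x)
          - (g ℓ : ℂ) * fourier ℓ x) := by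
        refine tsum_congr fun ℓ => ?_
        have : fourier ℓ x = fourier (-1) x * fourier (ℓ + 1) x := by
          rw [← fourier_add, neg_add_cancel_comm_assoc]
        rw [fwdDiff, Complex.ofReal_sub, sub_mul, mul_left_comm, ← this]
    _ = _ := by rw [(hs'.mul_left _).tsum_sub hs, tsum_mul_left, he]; ring

lemma tsum_fwdDiff_iter_mul_fourier {g : ℤ → ℝ} {n : ℤ} (hg : ∀ ℓ ∉ Finset.Ioo (-n) n, g ℓ = 0)
    (k : ℕ) (x : Torus) :
    ∑' ℓ, (((fwdDiff 1)^[k] g ℓ : ℝ) : ℂ) * fourier ℓ x =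
      (fourier (-1) x - 1) ^ k * ∑' ℓ, (g ℓ : ℂ) * fourier ℓ x := by
  induction k with
  | zero => simp
  | succ k ih =>
    rw [Function.iterate_succ', pow_succ', mul_assoc, ← ih]
    exact tsum_fwdDiff_mul_fourier (fwdDiff_iter_eq_zero hg k) x

lemma IsLowPass.exists_iteratedDeriv_bound {H : ℝ → ℝ} (hH : IsLowPass H)
    (hs : ContDiff ℝ (⊤ : ℕ∞) H) (k : ℕ) : ∃ M, ∀ y, |iteratedDeriv k H y| ≤ M := by
  have hc : HasCompactSupport H := HasCompactSupport.intro (isCompact_Icc (a := -1) (b := 1))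
    fun t ht => hH.zero t (by
      rw [Set.mem_Icc, ← abs_le, not_le] at ht
      exact ht.le)
  have hd : HasCompactSupport (iteratedDeriv k H) := by
    induction k with
    | zero => rwa [iteratedDeriv_zero]
    | succ k ih => rw [iteratedDeriv_succ]; exact ih.deriv
  exact (hs.continuous_iteratedDeriv k (by exact_mod_cast le_top)).bounded_above_of_compact_support
    hd

lemma IsLowPass.norm_kernel_le_one {H : ℝ → ℝ} (hH : IsLowPass H) {n : ℕ} (hn : 0 < n)
    (x : Torus) : ‖kernel H n x‖ ≤ 1 := by
  refine (hH.norm_sigma_le hn _ x).trans_eq ?_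
  simp [hH.sum_weight hn]

/-- Summation by parts `k` times leaves at most `2n + k` terms of size `n^{-k} M`; the bound `(H 0 *
n)⁻¹` for `hbar` removes the remaining factor `n`. -/
lemma IsLowPass.pow_mul_norm_kernel_le {H : ℝ → ℝ} (hH : IsLowPass H)
    (hs : ContDiff ℝ (⊤ : ℕ∞) H) {k : ℕ} {M : ℝ} (hM : ∀ y, |iteratedDeriv k H y| ≤ M)
    {n : ℕ} (hn : 0 < n) (x : Torus) :
    (n * ‖x‖) ^ k * ‖kernel H n x‖ ≤ (π / 2) ^ k * ((2 + k) * M / H 0) := by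
  have hn' : (0 : ℝ) < n := by exact_mod_cast hn
  have hn1 : (1 : ℝ) ≤ n := by exact_mod_cast hn
  have hM0 : 0 ≤ M := (abs_nonneg _).trans (hM 0)
  have hH0 := hH.pos
  set g : ℤ → ℝ := fun ℓ => H (ℓ * (n : ℝ)⁻¹) with hgdef
  have hg : ∀ ℓ ∉ Finset.Ioo (-(n : ℤ)) (n : ℤ), g ℓ = 0 := by
    intro ℓ hℓ
    refine hH.zero _ ?_
    have : (n : ℤ) ≤ |ℓ| := by
      rw [Finset.mem_Ioo, ← abs_lt, not_lt] at hℓ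
      exact hℓ
    have : (n : ℝ) ≤ |(ℓ : ℝ)| := by exact_mod_cast this
    rw [← div_eq_mul_inv, abs_div, Nat.abs_cast, le_div_iff₀ hn', one_mul]
    exact this
  have hker : kernel H n x = hbar H n * ∑' ℓ, (g ℓ : ℂ) * fourier ℓ x := by
    rw [tsum_eq_sum (s := Finset.Ioo (-(n : ℤ)) (n : ℤ)) fun ℓ hℓ => by simp [hg ℓ hℓ]]
    simp only [kernel, sigma, mul_one, hH.comp_abs_div]
    simp only [hgdef, div_eq_mul_inv]
  have hdiff : ‖∑' ℓ, (((fwdDiff 1)^[k] g ℓ : ℝ) : ℂ) * fourier ℓ x‖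
      ≤ (2 * n + k) * ((n : ℝ)⁻¹ ^ k * M) := by
    rw [tsum_eq_sum (s := Finset.Ioo (-(n : ℤ) - k) (n : ℤ)) fun ℓ hℓ => by
      simp [fwdDiff_iter_eq_zero hg k ℓ hℓ]]
    refine (norm_sum_le_of_le _ (f := fun ℓ => (((fwdDiff 1)^[k] g ℓ : ℝ) : ℂ) * fourier ℓ x)
      (n := fun _ => (n : ℝ)⁻¹ ^ k * M) fun ℓ _ => ?_).trans ?_
    · rw [norm_mul, Complex.norm_real, fourier_apply, Circle.norm_coe, mul_one, Real.norm_eq_abs,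
        hgdef, fwdDiff_iter_comp_mul]
      exact abs_fwdDiff_iter_le (by positivity) k hs hM _
    · rw [Finset.sum_const, Int.card_Ioo, nsmul_eq_mul]
      refine mul_le_mul_of_nonneg_right ?_ (by positivity)
      have : (((n : ℤ) - (-(n : ℤ) - k) - 1).toNat) ≤ 2 * n + k := by omega
      exact_mod_cast this
  rw [tsum_fwdDiff_iter_mul_fourier hg, norm_mul, norm_pow] at hdiff
  have hlow : 2 / π * ‖x‖ ≤ ‖fourier (-1) x - 1‖ := by
    refine (two_div_pi_mul_norm_le x).trans_eq ?_
    rw [fourier_neg, ← Complex.norm_conj, map_sub, map_one]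
  set T := ‖∑' ℓ, (g ℓ : ℂ) * fourier ℓ x‖
  have h1 : (2 / π * ‖x‖) ^ k * T ≤ (2 * n + k) * ((n : ℝ)⁻¹ ^ k * M) :=
    (mul_le_mul_of_nonneg_right (pow_le_pow_left₀ (by positivity) hlow k) (norm_nonneg _)).trans
      hdiff
  rw [hker, norm_mul, Complex.norm_real, Real.norm_of_nonneg (hH.hbar_pos hn).le]
  calc (n * ‖x‖) ^ k * (hbar H n * T)
      = (π / 2) ^ k * (hbar H n * ((n : ℝ) ^ k * ((2 / π * ‖x‖) ^ k * T))) := by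
        have : (n * ‖x‖) = π / 2 * (n * (2 / π * ‖x‖)) := by field_simp
        rw [this, mul_pow, mul_pow]
        ring
    _ ≤ (π / 2) ^ k * ((H 0 * n)⁻¹ * ((n : ℝ) ^ k * ((2 * n + k) * ((n : ℝ)⁻¹ ^ k * M)))) := by
        gcongr
        exact hH.hbar_le hn
    _ = (π / 2) ^ k * ((2 * n + k) / n * M / H 0) := by
        rw [inv_pow]
        field_simp
    _ ≤ (π / 2) ^ k * ((2 + k) * M / H 0) := by
        gcongr
        rw [div_le_iff₀ hn']
        have : (k : ℝ) ≤ k * n := le_mul_of_one_le_right (by positivity) hn1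
        linarith

theorem IsLowPass.exists_isLocConst {H : ℝ → ℝ} (hH : IsLowPass H) (hs : ContDiff ℝ (⊤ : ℕ∞) H)
    {S : ℝ} (hS : 0 ≤ S) : ∃ L, IsLocConst H S L := by
  obtain ⟨M, hM⟩ := hH.exists_iteratedDeriv_bound hs ⌈S⌉₊
  have hM0 : 0 ≤ M := (abs_nonneg _).trans (hM 0)
  have hH0 := hH.pos
  have hD : 0 ≤ (π / 2) ^ ⌈S⌉₊ * ((2 + ⌈S⌉₊) * M / H 0) := by positivity
  -- The summand 1 covers `n‖x‖ ≤ 1`, where the trivial bound suffices; the other covers `n‖x‖ ≥ 1`,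
  -- where raising the exponent to `⌈S⌉₊` is harmless.
  refine ⟨1 + (π / 2) ^ ⌈S⌉₊ * ((2 + ⌈S⌉₊) * M / H 0), by linarith, fun n hn x => ?_⟩
  rw [le_div_iff₀ (lt_max_of_lt_left one_pos)]
  have h1 := hH.norm_kernel_le_one hn x
  have h2 := hH.pow_mul_norm_kernel_le hs hM hn x
  have h0 := norm_nonneg (kernel H n x)
  rcases le_total ((n * ‖x‖) ^ S) 1 with h | h
  · rw [max_eq_left h]; linarith
  · rw [max_eq_right h]
    rcases le_total 1 (n * ‖x‖) with hx | hx
    · have := rpow_le_rpow_of_exponent_le hx (Nat.le_ceil S)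
      rw [rpow_natCast] at this
      nlinarith
    · have := rpow_le_one (by positivity) hx hS
      nlinarith

/-! ### Discretizing the maximum of a trigonometric polynomial -/

lemma integral_fourier_mul_fourier (ℓ m : ℤ) :
    ∫ x : Torus, fourier (-ℓ) x * fourier m x ∂AddCircle.haarAddCircle = if m = ℓ then 1 else 0 := by
  simp only [← fourier_add]
  split_ifs with h
  · simp [h]
  · exact integral_eq_zero_of_add_right_eq_neg (μ := AddCircle.haarAddCircle)
      (fourier_add_half_inv_index (by omega) two_pi_pos)

/-- The coefficients of a trigonometric polynomial are bounded by its maximum. -/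
lemma norm_coeff_le (s : Finset ℤ) (c : ℤ → ℂ) {B : ℝ}
    (hB : ∀ x : Torus, ‖∑ ℓ ∈ s, c ℓ * fourier ℓ x‖ ≤ B) {ℓ : ℤ} (hℓ : ℓ ∈ s) : ‖c ℓ‖ ≤ B := by
  have hint : ∀ m : ℤ, Integrable (fun x : Torus => c m * (fourier (-ℓ) x * fourier m x))
      AddCircle.haarAddCircle := fun m =>
    (by fun_prop : Continuous fun x : Torus => c m * (fourier (-ℓ) x * fourier m x)
      ).integrable_of_hasCompactSupport (HasCompactSupport.of_compactSpace _)
  have h : ∫ x : Torus, fourier (-ℓ) x * ∑ m ∈ s, c m * fourier m x ∂AddCircle.haarAddCircle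
      = c ℓ := by
    simp only [Finset.mul_sum, mul_left_comm]
    rw [integral_finsetSum _ fun m _ => hint m]
    simp only [integral_const_mul, integral_fourier_mul_fourier]
    simp [hℓ]
  rw [← h]
  refine (norm_integral_le_of_norm_le_const (C := B) (.of_forall fun x => ?_)).trans_eq (by simp)
  rw [norm_mul, fourier_apply, Circle.norm_coe, one_mul]
  exact hB x

/-- A trigonometric polynomial of degree less than `n` is Lipschitz, with a constant controlled by
its maximum. -/
lemma norm_sigma_sub_le (H : ℝ → ℝ) (n : ℕ) (a : ℤ → ℂ) {B : ℝ}
    (hB : ∀ x, ‖sigma H n a x‖ ≤ B) (x y : Torus) :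
    ‖sigma H n a x - sigma H n a y‖ ≤ 2 * n ^ 2 * B * ‖x - y‖ := by
  have hB0 : 0 ≤ B := (norm_nonneg _).trans (hB 0)
  simp only [sigma_eq_sum_weight] at hB ⊢
  rw [← Finset.sum_sub_distrib]
  -- A crude Bernstein inequality, term by term. The extra factor of order `n` only enlarges the
  -- grid, hence only affects a logarithm.
  refine (norm_sum_le_of_le _ (n := fun _ => B * (n * ‖x - y‖)) fun ℓ hℓ => ?_).trans ?_
  · rw [← mul_sub, norm_mul]
    refine mul_le_mul (norm_coeff_le _ _ hB hℓ) ((norm_fourier_sub_le ℓ x y).trans ?_)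
      (norm_nonneg _) hB0
    refine mul_le_mul_of_nonneg_right ?_ (norm_nonneg _)
    rw [Finset.mem_Ioo, ← abs_lt] at hℓ
    exact_mod_cast hℓ.le
  · rw [Finset.sum_const, Int.card_Ioo, nsmul_eq_mul]
    have : ((n : ℤ) - -(n : ℤ) - 1).toNat ≤ 2 * n := by omega
    have : ((((n : ℤ) - -(n : ℤ) - 1).toNat : ℕ) : ℝ) ≤ 2 * n := by exact_mod_cast this
    calc _ ≤ 2 * (n : ℝ) * (B * (n * ‖x - y‖)) := by gcongr
      _ = _ := by ring

/-- The points `kπ / (16n²)` of the circle. -/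
def gridPoint (n : ℕ) (k : ℤ) : Torus := ((k * (π / (16 * n ^ 2)) : ℝ) : Torus)

/-- Indices of the grid points that cover the circle. -/
def gridIndex (n : ℕ) : Finset ℤ := Finset.Icc (-(16 * n ^ 2)) (16 * n ^ 2)

lemma exists_norm_sub_gridPoint_le {n : ℕ} (hn : 0 < n) (x : Torus) :
    ∃ k ∈ gridIndex n, ‖x - gridPoint n k‖ ≤ π / (16 * n ^ 2) := by
  obtain ⟨y, rfl, -, hy⟩ := exists_coe_eq_abs_eq_norm x
  have hn' : (0 : ℝ) < n := by exact_mod_cast hn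
  have hh : 0 < π / (16 * (n : ℝ) ^ 2) := by positivity
  have hM : (16 * (n : ℝ) ^ 2) * (π / (16 * (n : ℝ) ^ 2)) = π := by field_simp
  set h := π / (16 * (n : ℝ) ^ 2) with hdef
  rw [abs_le] at hy
  refine ⟨⌊y / h⌋, Finset.mem_Icc.2 ⟨?_, ?_⟩, ?_⟩
  · rw [Int.le_floor, le_div_iff₀ hh]
    push_cast
    linarith
  · have : (⌊y / h⌋ : ℝ) ≤ 16 * (n : ℝ) ^ 2 :=
      (Int.floor_le _).trans ((div_le_iff₀ hh).2 (by linarith))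
    exact_mod_cast this
  · have h1 : ⌊y / h⌋ * h ≤ y := (le_div_iff₀ hh).1 (Int.floor_le _)
    have h2 : y < (⌊y / h⌋ + 1) * h := (div_lt_iff₀ hh).1 (Int.lt_floor_add_one _)
    rw [gridPoint, ← AddCircle.coe_sub, ← hdef]
    refine QuotientAddGroup.norm_mk_le_norm.trans ?_
    rw [Real.norm_eq_abs, abs_le]
    constructor <;> linarith

/-- Moving from a maximum point to the nearby grid point loses at most the fraction `2n² · π/(16n²)
= π/8 ≤ 1/2` of the maximum. -/
lemma exists_gridPoint_half_le {n : ℕ} (hn : 0 < n) (H : ℝ → ℝ) (a : ℤ → ℂ) (x : Torus) :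
    ∃ k ∈ gridIndex n, ‖sigma H n a x‖ / 2 ≤ ‖sigma H n a (gridPoint n k)‖ := by
  have hn' : (0 : ℝ) < n := by exact_mod_cast hn
  obtain ⟨z, -, hz⟩ := isCompact_univ.exists_isMaxOn (Set.univ_nonempty (α := Torus))
    (continuous_sigma H n a).norm.continuousOn
  have hmax : ∀ y, ‖sigma H n a y‖ ≤ ‖sigma H n a z‖ := fun y => hz (Set.mem_univ y)
  obtain ⟨k, hk, hzk⟩ := exists_norm_sub_gridPoint_le hn z
  refine ⟨k, hk, ?_⟩
  have h1 := norm_sigma_sub_le H n a hmax z (gridPoint n k)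
  have h2 : 2 * (n : ℝ) ^ 2 * ‖sigma H n a z‖ * ‖z - gridPoint n k‖ ≤ ‖sigma H n a z‖ / 2 := by
    calc _ ≤ 2 * (n : ℝ) ^ 2 * ‖sigma H n a z‖ * (π / (16 * n ^ 2)) := by gcongr
      _ = ‖sigma H n a z‖ * (π / 8) := by field_simp; ring
      _ ≤ ‖sigma H n a z‖ * (1 / 2) := 
        mul_le_mul_of_nonneg_left (by linarith [pi_le_four]) (norm_nonneg _)
      _ = _ := by ring
  have h3 := norm_sub_norm_le (sigma H n a z) (sigma H n a (gridPoint n k))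
  linarith [hmax x]

/-! ### The noise estimate -/

section Probability

variable {Ω : Type*} [MeasurableSpace Ω] {P : Measure Ω}

lemma _root_.ProbabilityTheory.HasSubgaussianMGF.mono {X : Ω → ℝ} {c d : ℝ≥0}
    (h : HasSubgaussianMGF X c P) (hcd : c ≤ d) : HasSubgaussianMGF X d P where
  integrable_exp_mul := h.integrable_exp_mul
  mgf_le t := (h.mgf_le t).trans (by gcongr)

lemma _root_.ProbabilityTheory.HasSubgaussianMGF.const_mul_toNNReal {X : Ω → ℝ} {c : ℝ}
    (h : HasSubgaussianMGF X c.toNNReal P) (r : ℝ) :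
    HasSubgaussianMGF (fun ω => r * X ω) (r ^ 2 * c).toNNReal P := by
  refine (h.const_mul r).mono ?_
  rw [Real.toNNReal_mul (sq_nonneg r), Real.toNNReal_of_nonneg (sq_nonneg r)]
  exact le_rfl

/-- Real and imaginary parts may be dependent, so the proxies combine as `(√a + √b)² ≤ 2(a + b)`;
hence the factor 2. -/
lemma IsComplexSubgaussian.re_mul {Z : Ω → ℂ} {V : ℝ} (h : IsComplexSubgaussian Z V P) {u : ℂ}
    (hu : ‖u‖ = 1) : HasSubgaussianMGF (fun ω => (Z ω * u).re) (2 * V ^ 2).toNNReal P := by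
  have h1 := (h.2.1.2.const_mul_toNNReal u.re).add (h.2.2.2.const_mul_toNNReal (-u.im))
  have h2 : (fun ω => (Z ω * u).re) = fun ω => u.re * (Z ω).re + -u.im * (Z ω).im := by
    ext ω
    rw [Complex.mul_re]
    ring
  rw [h2]
  refine h1.mono ?_
  have hu' : u.re ^ 2 + u.im ^ 2 = 1 := by
    have := Complex.sq_norm u
    rw [hu, Complex.normSq_apply] at this
    linarith
  rw [← NNReal.coe_le_coe, Real.coe_toNNReal _ (by positivity)]
  push_cast
  rw [Real.coe_toNNReal _ (by positivity), Real.coe_toNNReal _ (by positivity)]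
  have hA := Real.sq_sqrt (by positivity : 0 ≤ u.re ^ 2 * V ^ 2)
  have hB := Real.sq_sqrt (by positivity : 0 ≤ (-u.im) ^ 2 * V ^ 2)
  have : 2 * V ^ 2 = 2 * (u.re ^ 2 * V ^ 2 + (-u.im) ^ 2 * V ^ 2) := by
    rw [neg_sq, ← add_mul, hu', one_mul]
  nlinarith [sq_nonneg (√(u.re ^ 2 * V ^ 2) - √((-u.im) ^ 2 * V ^ 2))]

variable {H : ℝ → ℝ} {V : ℝ} {n : ℕ} {e : ℤ → Ω → ℂ}

lemma IsNoise.hasSubgaussianMGF_re_sigma_mul (hH : IsLowPass H) (hn : 0 < n)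
    (he : IsNoise P V n e) (x : Torus) {u : ℂ} (hu : ‖u‖ = 1) :
    HasSubgaussianMGF (fun ω => (sigma H n (fun ℓ => e ℓ ω) x * u).re) (2 * V ^ 2 / n).toNNReal
      P := by
  have hmem : ∀ ℓ : ℤ, ℓ ∈ Finset.Ioo (-(n : ℤ)) (n : ℤ) ↔ ℓ ∈ Set.Ioo (-(n : ℤ)) (n : ℤ) :=
    fun ℓ => by rw [Finset.mem_Ioo, Set.mem_Ioo]
  have hsum : ∀ f : ℤ → ℝ, ∑ ℓ ∈ Finset.Ioo (-(n : ℤ)) (n : ℤ), f ℓ =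
      ∑ ℓ : Set.Ioo (-(n : ℤ)) (n : ℤ), f ℓ := fun f => Finset.sum_subtype _ hmem f
  have hind : iIndepFun (fun (ℓ : Set.Ioo (-(n : ℤ)) (n : ℤ)) ω =>
      weight H n ℓ * (e ℓ ω * (fourier (ℓ : ℤ) x * u)).re) P :=
    he.indep.comp (fun ℓ z => weight H n ℓ * (z * (fourier (ℓ : ℤ) x * u)).re)
      fun ℓ => by fun_prop
  have hsub := HasSubgaussianMGF.sum_of_iIndepFun hind (s := Finset.univ) fun ℓ _ =>
    ((he.subgaussian ℓ).re_mul (u := fourier (ℓ : ℤ) x * u)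
      (by rw [norm_mul, fourier_apply, Circle.norm_coe, hu, one_mul])).const_mul_toNNReal (weight H n ℓ)
  have heq : (fun ω => (sigma H n (fun ℓ => e ℓ ω) x * u).re) = fun ω =>
      ∑ ℓ : Set.Ioo (-(n : ℤ)) (n : ℤ), weight H n ℓ * (e ℓ ω * (fourier (ℓ : ℤ) x * u)).re := by
    ext ω
    rw [← hsum fun ℓ => weight H n ℓ * (e ℓ ω * (fourier (ℓ : ℤ) x * u)).re, sigma_eq_sum_weight,
      Finset.sum_mul, Complex.re_sum]
    refine Finset.sum_congr rfl fun ℓ _ => ?_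
    rw [mul_assoc, mul_assoc, Complex.re_ofReal_mul]
  rw [heq]
  refine hsub.mono ?_
  rw [← NNReal.coe_le_coe, Real.coe_toNNReal _ (by positivity), NNReal.coe_sum]
  refine (Finset.sum_congr rfl fun ℓ _ => Real.coe_toNNReal _ (by positivity)).trans_le ?_
  rw [← hsum fun ℓ => weight H n ℓ ^ 2 * (2 * V ^ 2), ← Finset.sum_mul]
  calc _ ≤ 1 / (n : ℝ) * (2 * V ^ 2) :=
        mul_le_mul_of_nonneg_right (hH.sum_weight_sq_le hn) (by positivity)
    _ = _ := by ring

lemma IsNoise.measureReal_le_norm_sigma [IsFiniteMeasure P] (hH : IsLowPass H) (hn : 0 < n)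
    (he : IsNoise P V n e) (x : Torus) {s : ℝ} (hs : 0 ≤ s) :
    P.real {ω | s ≤ ‖sigma H n (fun ℓ => e ℓ ω) x‖} ≤ 4 * exp (-(s ^ 2 * n / (16 * V ^ 2))) := by
  have key : ∀ u : ℂ, ‖u‖ = 1 → P.real {ω | s / 2 ≤ (sigma H n (fun ℓ => e ℓ ω) x * u).re} ≤
      exp (-(s ^ 2 * n / (16 * V ^ 2))) := by
    intro u hu
    refine ((he.hasSubgaussianMGF_re_sigma_mul hH hn x hu).measure_ge_le
      (by positivity : 0 ≤ s / 2)).trans_eq ?_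
    rw [Real.coe_toNNReal _ (by positivity)]
    congr 1
    have hn' : (n : ℝ) ≠ 0 := by positivity
    rcases eq_or_ne V 0 with rfl | hV
    · simp
    · field_simp
      ring
  -- As `|z| ≤ |Re z| + |Im z|`, a modulus of at least `s` forces a component of at least `s/2` in
  -- one of the directions `±1, ±i`.
  have hsub : {ω | s ≤ ‖sigma H n (fun ℓ => e ℓ ω) x‖} ⊆
      ({ω | s / 2 ≤ (sigma H n (fun ℓ => e ℓ ω) x * 1).re} ∪
        {ω | s / 2 ≤ (sigma H n (fun ℓ => e ℓ ω) x * (-1)).re}) ∪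
      ({ω | s / 2 ≤ (sigma H n (fun ℓ => e ℓ ω) x * Complex.I).re} ∪
        {ω | s / 2 ≤ (sigma H n (fun ℓ => e ℓ ω) x * (-Complex.I)).re}) := by
    intro ω hω
    simp only [Set.mem_union, Set.mem_ofPred_eq, mul_one, mul_neg, Complex.neg_re,
      Complex.mul_I_re, neg_neg] at hω ⊢
    have h := Complex.norm_le_abs_re_add_abs_im (sigma H n (fun ℓ => e ℓ ω) x)
    by_contra! hcon
    obtain ⟨⟨h1, h2⟩, h3, h4⟩ := hcon
    have := abs_lt.2 ⟨by linarith, h1⟩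
    have := abs_lt.2 ⟨by linarith, h4⟩
    linarith
  refine (measureReal_mono hsub).trans ?_
  refine (measureReal_union_le _ _).trans ?_
  have h1 := measureReal_union_le (μ := P) {ω | s / 2 ≤ (sigma H n (fun ℓ => e ℓ ω) x * 1).re}
    {ω | s / 2 ≤ (sigma H n (fun ℓ => e ℓ ω) x * (-1)).re}
  have h2 := measureReal_union_le (μ := P)
    {ω | s / 2 ≤ (sigma H n (fun ℓ => e ℓ ω) x * Complex.I).re}
    {ω | s / 2 ≤ (sigma H n (fun ℓ => e ℓ ω) x * (-Complex.I)).re}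
  have := key 1 (by simp)
  have := key (-1) (by simp)
  have := key Complex.I (by simp)
  have := key (-Complex.I) (by simp)
  linarith

theorem IsNoise.measureReal_exists_le_norm_sigma_lt [IsFiniteMeasure P] (hH : IsLowPass H)
    (hn : 0 < n) (hV : 0 < V) {δ : ℝ} (hδ : 0 < δ) (hδ1 : δ < 1) (he : IsNoise P V n e) :
    P.real {ω | ∃ x, noiseLevel 16 20 V δ n ≤ ‖sigma H n (fun ℓ => e ℓ ω) x‖} < δ := by
  have hn1 : (1 : ℝ) ≤ n := by exact_mod_cast hn
  have hn' : (0 : ℝ) < n := by linarith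
  set q := 20 * n / δ with hq
  have hq20 : 20 * n ≤ q := by
    rw [hq, le_div_iff₀ hδ]
    nlinarith
  have hq0 : 0 < q := by linarith
  have hlog : 0 ≤ log q := log_nonneg (by linarith)
  set s := noiseLevel 16 20 V δ n with hs
  have hs0 : 0 ≤ s := by
    rw [hs, noiseLevel]; positivity
  have hs2 : (s / 2) ^ 2 * n / (16 * V ^ 2) = 4 * log q := by
    rw [hs, noiseLevel, div_pow, mul_pow, sq_sqrt (by positivity), ← hq]
    field_simp
    ring
  -- The level 16 gives `q⁻⁴`; `q⁻²` already beats the `33n²` grid points with four directions each,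
  -- since `33 · 4 < 20²`.
  have hexp : exp (-((s / 2) ^ 2 * n / (16 * V ^ 2))) ≤ (q ^ 2)⁻¹ := by
    rw [hs2, exp_neg]
    refine inv_anti₀ (by positivity) ?_
    calc q ^ 2 = exp (2 * log q) := by
          rw [show 2 * log q = log q + log q by ring, exp_add, exp_log hq0, sq]
      _ ≤ exp (4 * log q) := exp_le_exp.2 (by linarith)
  have hsub : {ω | ∃ x, s ≤ ‖sigma H n (fun ℓ => e ℓ ω) x‖} ⊆
      ⋃ k ∈ gridIndex n, {ω | s / 2 ≤ ‖sigma H n (fun ℓ => e ℓ ω) (gridPoint n k)‖} := by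
    rintro ω ⟨x, hx⟩
    obtain ⟨k, hk, h⟩ := exists_gridPoint_half_le hn H (fun ℓ => e ℓ ω) x
    simp only [Set.mem_iUnion]
    exact ⟨k, hk, (div_le_div_of_nonneg_right hx two_pos.le).trans h⟩
  have hcard : ((gridIndex n).card : ℝ) ≤ 33 * n ^ 2 := by
    have hc : (gridIndex n).card = 32 * n ^ 2 + 1 := by
      rw [gridIndex, Int.card_Icc]
      have : (16 * (n : ℤ) ^ 2 + 1 - -(16 * (n : ℤ) ^ 2)) = ((32 * n ^ 2 + 1 : ℕ) : ℤ) := by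
        push_cast; ring
      rw [this, Int.toNat_natCast]
    rw [hc]
    push_cast
    nlinarith
  calc _ ≤ P.real (⋃ k ∈ gridIndex n,
          {ω | s / 2 ≤ ‖sigma H n (fun ℓ => e ℓ ω) (gridPoint n k)‖}) :=
        measureReal_mono hsub (measure_ne_top _ _)
    _ ≤ ∑ k ∈ gridIndex n, P.real
          {ω | s / 2 ≤ ‖sigma H n (fun ℓ => e ℓ ω) (gridPoint n k)‖} :=
        measureReal_biUnion_finset_le _ _
    _ ≤ ∑ k ∈ gridIndex n, 4 * (q ^ 2)⁻¹ := Finset.sum_le_sum fun k _ =>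
        (he.measureReal_le_norm_sigma hH hn _ (by positivity)).trans (by gcongr)
    _ ≤ 33 * n ^ 2 * (4 * (q ^ 2)⁻¹) := by
        rw [Finset.sum_const, nsmul_eq_mul]
        gcongr
    _ = 33 * 4 / 400 * (δ * δ) := by
        rw [hq]
        field_simp
        norm_num
    _ < δ := by nlinarith

end Probability

/-! ### Separating the peaks of a superposition of kernels -/

lemma fourier_sub_apply (ℓ : ℤ) (x y : Torus) :
    fourier ℓ (x - y) = fourier ℓ x * fourier (-ℓ) y := by
  rw [fourier_apply, fourier_apply, fourier_apply, smul_sub, sub_eq_add_neg, AddCircle.toCircle_add,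
    Circle.coe_mul, neg_smul]

/-- A perturbed superposition of translates of a kernel `Φ` that is concentrated near `0`
separates the centres. -/
lemma separates_of_norm_sub_le {K n : ℕ} (hn : 0 < n) {g Φ : Torus → ℂ} (hg : Continuous g)
    {c : Fin K → ℂ} {lam : Fin K → Torus} {m C : ℝ} {η : ℝ≥0∞} (hm : 0 < m)
    (hmc : ∀ j, m ≤ ‖c j‖) (hC : 1 ≤ C)
    (hnear : ∀ y, ‖y‖ ≤ 1 / (4 * n) → 31 / 32 ≤ ‖Φ y‖)
    (hfar : ∀ y, C / n ≤ ‖y‖ → (∑ j, ‖c j‖) * ‖Φ y‖ ≤ m / 16)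
    (hfar' : ∀ y, 3 * C / n ≤ ‖y‖ → (∑ j, ‖c j‖) * ‖Φ y‖ ≤ m / 144)
    (hη : ∀ ℓ k, ℓ ≠ k → η ≤ edist (lam ℓ) (lam k))
    (hsep : ∀ ℓ k, ℓ ≠ k → 4 * C / n ≤ dist (lam ℓ) (lam k))
    (herr : ∀ x, ‖g x - ∑ j, c j * Φ (x - lam j)‖ ≤ 3 * m / 16) :
    Separates g (3 * m / 4) C n η lam := by
  have hn' : (0 : ℝ) < n := by exact_mod_cast hn
  have hsplit : ∀ q : ℝ, q / n = q * (1 / n) := fun q => div_eq_mul_one_div _ _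
  have h1n : 0 < 1 / (n : ℝ) := by positivity
  have hquarter : 1 / (4 * (n : ℝ)) = 1 / n / 4 := by ring
  have hCn : 1 / (4 * (n : ℝ)) ≤ C / n := by
    rw [hquarter, hsplit C]
    nlinarith
  have hC0 : 0 ≤ C / n := by positivity
  have hsum : ∀ (s : Finset (Fin K)) (x : Torus) (b : ℝ), 0 ≤ b →
      (∀ j ∈ s, (∑ i, ‖c i‖) * ‖Φ (x - lam j)‖ ≤ b) → ‖∑ j ∈ s, c j * Φ (x - lam j)‖ ≤ b := by
    intro s x b hb h
    rcases (Finset.sum_nonneg fun i (_ : i ∈ Finset.univ) => norm_nonneg (c i)).eq_or_lt with h0 | h0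
    · have : ∀ j, c j = 0 := fun j =>
        norm_eq_zero.1 ((Finset.sum_eq_zero_iff_of_nonneg fun i _ => norm_nonneg (c i)).1 h0.symm j
          (Finset.mem_univ j))
      simpa [this] using hb
    · calc ‖∑ j ∈ s, c j * Φ (x - lam j)‖ ≤ ∑ j ∈ s, ‖c j‖ * (b / ∑ i, ‖c i‖) := by
            refine norm_sum_le_of_le _ fun j hj => ?_
            rw [norm_mul]
            refine mul_le_mul_of_nonneg_left ?_ (norm_nonneg _)
            rw [le_div_iff₀ h0, mul_comm]
            exact h j hj
        _ ≤ ∑ j, ‖c j‖ * (b / ∑ i, ‖c i‖) :=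
            Finset.sum_le_sum_of_subset_of_nonneg (Finset.subset_univ _) fun _ _ _ => by positivity
        _ = b := by rw [← Finset.sum_mul, mul_div_cancel₀ _ h0.ne']
  -- Away from all centres the modulus is at most `m/16 + 3m/16 = m/4`.
  have hmem : ∀ x, 3 * m / 4 ≤ ‖g x‖ → ∃ ℓ, ‖x - lam ℓ‖ ≤ C / n := by
    intro x hx
    by_contra! hcon
    have h1 := hsum Finset.univ x (m / 16) (by positivity) fun j _ => hfar _ (hcon j).le
    have h2 := norm_sub_norm_le (g x) (∑ j, c j * Φ (x - lam j))
    linarith [herr x]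
  -- The other centres are at distance at least `4C/n - 1/(4n) ≥ 3C/n`, and `31/32 - 1/144 - 3/16 >
  -- 3/4`. The weaker tail bound `m/16` would not suffice here.
  have hpeak : ∀ ℓ x, ‖x - lam ℓ‖ ≤ 1 / (4 * n) → 3 * m / 4 ≤ ‖g x‖ := by
    intro ℓ x hx
    have h1 := hsum (Finset.univ.erase ℓ) x (m / 144) (by positivity) fun j hj => by
      refine hfar' _ ?_
      have h := hsep ℓ j (Finset.ne_of_mem_erase hj).symm
      have h' := dist_triangle_left (lam ℓ) (lam j) x
      rw [dist_eq_norm x, dist_eq_norm x] at h'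
      rw [hsplit] at h ⊢
      rw [hsplit] at hCn
      linarith
    have h2 := norm_sub_norm_le (∑ j, c j * Φ (x - lam j)) (∑ j, c j * Φ (x - lam j) - g x)
    rw [sub_sub_cancel, norm_sub_rev _ (g x)] at h2
    have h3 := norm_sub_norm_le (c ℓ * Φ (x - lam ℓ))
      (-∑ j ∈ Finset.univ.erase ℓ, c j * Φ (x - lam j))
    rw [sub_neg_eq_add, Finset.add_sum_erase _ (fun j => c j * Φ (x - lam j)) (Finset.mem_univ ℓ),
      norm_neg, norm_mul] at h3
    have h4 : m * (31 / 32) ≤ ‖c ℓ‖ * ‖Φ (x - lam ℓ)‖ :=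
      mul_le_mul (hmc ℓ) (hnear _ hx) (by norm_num) (norm_nonneg _)
    linarith [herr x]
  have hdist : ∀ ℓ k, ℓ ≠ k → ∀ x y, ‖x - lam ℓ‖ ≤ C / n → ‖y - lam k‖ ≤ C / n →
      dist (lam ℓ) (lam k) / 2 ≤ dist x y := by
    intro ℓ k hne x y hx hy
    have h1 := hsep ℓ k hne
    have h2 := dist_triangle4 (lam ℓ) x y (lam k)
    rw [dist_comm (lam ℓ) x, dist_eq_norm x (lam ℓ), dist_eq_norm y] at h2
    rw [mul_div_assoc] at h1
    linarith
  -- By `hmem` the balls of radius `C/n` cover the level set; being closed, they make the pieces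
  -- compact, so maxima are attained.
  refine ⟨fun ℓ => levelSet g (3 * m / 4) ∩ Metric.closedBall (lam ℓ) (C / n), ?_, ?_, ?_, ?_, ?_,
    ?_, ?_⟩
  · rw [← Set.inter_iUnion, eq_comm, Set.inter_eq_left]
    intro x hx
    obtain ⟨ℓ, hℓ⟩ := hmem x hx
    exact Set.mem_iUnion.2 ⟨ℓ, by rwa [Metric.mem_closedBall, dist_eq_norm]⟩
  · intro ℓ k hne
    refine Set.disjoint_left.2 fun x hx hx' => ?_
    have h := hdist ℓ k hne x x (by simpa [dist_eq_norm] using hx.2)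
      (by simpa [dist_eq_norm] using hx'.2)
    have := hsep ℓ k hne
    have : 0 < 4 * C / n := by positivity
    rw [dist_self] at h
    linarith
  · intro ℓ
    exact (Metric.diam_mono Set.inter_subset_right Metric.isBounded_closedBall).trans
      ((Metric.diam_closedBall hC0).trans_eq (mul_div_assoc _ _ _).symm)
  · intro ℓ k hne x hx y hy
    have h := hdist ℓ k hne x y (by simpa [dist_eq_norm] using hx.2)
      (by simpa [dist_eq_norm] using hy.2)
    calc η / 2 ≤ edist (lam ℓ) (lam k) / 2 := ENNReal.div_le_div_right (hη ℓ k hne) _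
      _ = ENNReal.ofReal (dist (lam ℓ) (lam k) / 2) := by
          rw [edist_dist, ENNReal.ofReal_div_of_pos two_pos, ENNReal.ofReal_ofNat]
      _ ≤ edist x y := by
          rw [edist_dist x y]
          exact ENNReal.ofReal_le_ofReal h
  · intro ℓ x hx
    refine ⟨hpeak ℓ x hx, ?_⟩
    rw [Metric.mem_closedBall, dist_eq_norm]
    exact le_trans hx hCn
  · intro ℓ
    have hcl : IsClosed (levelSet g (3 * m / 4)) := isClosed_le continuous_const hg.norm
    refine ((hcl.inter Metric.isClosed_closedBall).isCompact).exists_isMaxOn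
      ⟨lam ℓ, hpeak ℓ _ ?_, Metric.mem_closedBall_self hC0⟩ hg.norm.continuousOn
    rw [sub_self, norm_zero]
    positivity
  · intro ℓ x hx _
    have := hx.2
    rw [Metric.mem_closedBall, dist_eq_norm] at this
    rw [mul_div_assoc]
    linarith

/-- The real part is a weighted mean of `cos (ℓy)` with `|ℓy| ≤ 1/4`, and `cos ≥ 1 - 1/32` there. -/
lemma IsLowPass.le_norm_kernel {H : ℝ → ℝ} (hH : IsLowPass H) {n : ℕ} (hn : 0 < n) {x : Torus}
    (hx : ‖x‖ ≤ 1 / (4 * n)) : 31 / 32 ≤ ‖kernel H n x‖ := by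
  have hn' : (0 : ℝ) < n := by exact_mod_cast hn
  obtain ⟨y, rfl, hy, -⟩ := exists_coe_eq_abs_eq_norm x
  rw [← hy] at hx
  refine le_trans ?_ (Complex.re_le_norm _)
  rw [kernel, sigma_eq_sum_weight, Complex.re_sum]
  calc (31 / 32 : ℝ) = ∑ ℓ ∈ Finset.Ioo (-(n : ℤ)) (n : ℤ), weight H n ℓ * (31 / 32) := by
        rw [← Finset.sum_mul, hH.sum_weight hn, one_mul]
    _ ≤ _ := by
        refine Finset.sum_le_sum fun ℓ hℓ => ?_
        rw [mul_one, Complex.re_ofReal_mul, fourier_coe_eq_exp, mul_comm Complex.I,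
          Complex.exp_ofReal_mul_I_re]
        refine mul_le_mul_of_nonneg_left ?_ (hH.weight_nonneg hn ℓ)
        rw [Finset.mem_Ioo, ← abs_lt] at hℓ
        have hℓ' : |(ℓ : ℝ)| ≤ n := by exact_mod_cast hℓ.le
        have h1 : |ℓ * y| ≤ 1 / 4 := by
          rw [abs_mul]
          calc _ ≤ (n : ℝ) * (1 / (4 * n)) := by gcongr
            _ = 1 / 4 := by field_simp
        have h2 : (ℓ * y) ^ 2 ≤ (1 / 4) ^ 2 := sq_le_sq' (abs_le.1 h1).1 (abs_le.1 h1).2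
        have := one_sub_sq_div_two_le_cos (x := ℓ * y)
        linarith

/-! ### Local approximation of the signal by pure frequencies -/

section Signal

variable {K : ℕ} {A : Fin K → ℝ → ℂ} {φ : Fin K → ℝ → ℝ} {t α Δ : ℝ}

lemma norm_mul_exp_I (z : ℂ) (y : ℝ) : ‖z * Complex.exp (Complex.I * y)‖ = ‖z‖ := by
  rw [norm_mul, mul_comm Complex.I, Complex.norm_exp_ofReal_mul_I, mul_one]

lemma minAmp_le (j : Fin K) : minAmp A φ t ≤ ‖A j t‖ := by
  rw [← norm_mul_exp_I (A j t) (φ j t)]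
  exact ciInf_le (Set.finite_range _).bddBelow j

lemma minAmp_pos (hK : 1 ≤ K) (hA : ∀ j, A j t ≠ 0) : 0 < minAmp A φ t := by
  have : Nonempty (Fin K) := ⟨⟨0, hK⟩⟩
  obtain ⟨j, hj⟩ := exists_eq_ciInf_of_finite
    (f := fun j => ‖A j t * Complex.exp (Complex.I * φ j t)‖)
  rw [minAmp, ← hj, norm_mul_exp_I]
  exact norm_pos_iff.2 (hA j)

lemma minAmp_le_sumAmp (hK : 1 ≤ K) : minAmp A φ t ≤ sumAmp A t :=
  (minAmp_le ⟨0, hK⟩).trans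
    (Finset.single_le_sum (f := fun j => ‖A j t‖) (fun _ _ => norm_nonneg _) (Finset.mem_univ _))

lemma abs_deriv_le_maxFreq (j : Fin K) : |deriv (φ j) t| ≤ maxFreq φ t :=
  le_ciSup (f := fun j => |deriv (φ j) t|) (Set.finite_range _).bddAbove j

/-- First order Taylor estimate for the phases. -/
lemma SlowlyVarying.abs_phase_sub_le (h : SlowlyVarying A φ t α Δ) (hα : 0 ≤ α) (j : Fin K) {u : ℝ}
    (hu : |u| ≤ Δ) :
    |φ j (t + u) - (φ j t + deriv (φ j) t * u)| ≤ α * |u| ^ 2 * |deriv (φ j) t| := by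
  set I := Set.Icc (t - Δ) (t + Δ)
  set d := deriv (φ j) t
  have hsub : Set.uIcc t (t + u) ⊆ I := by
    have := abs_le.1 hu
    have := abs_nonneg u
    refine Set.uIcc_subset_Icc ⟨?_, ?_⟩ ⟨?_, ?_⟩ <;> linarith
  have hder : ∀ s ∈ Set.uIcc t (t + u), HasDerivWithinAt (fun s => φ j s - d * s)
      (derivWithin (φ j) I s - d) (Set.uIcc t (t + u)) s := by
    intro s hs
    have h1 := (((h.contDiffOn j).differentiableOn one_ne_zero) s
      (hsub hs)).hasDerivWithinAt.mono hsub
    have h2 := ((hasDerivAt_id s).const_mul d).hasDerivWithinAt (s := Set.uIcc t (t + u))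
    rw [mul_one] at h2
    exact h1.sub h2
  have hbound : ∀ s ∈ Set.uIcc t (t + u), ‖derivWithin (φ j) I s - d‖ ≤ α * |u| * |d| := by
    intro s hs
    have hs' : |s - t| ≤ |u| := by
      simpa using Set.abs_sub_left_of_mem_uIcc hs
    have := h.freq j (s - t) (hs'.trans hu)
    rw [add_sub_cancel] at this
    exact this.trans (by gcongr)
  have := (convex_uIcc t (t + u)).norm_image_sub_le_of_norm_hasDerivWithin_le hder hbound
    Set.left_mem_uIcc Set.right_mem_uIcc
  rw [add_sub_cancel_left, Real.norm_eq_abs, Real.norm_eq_abs] at this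
  calc _ = |φ j (t + u) - d * (t + u) - (φ j t - d * t)| := by congr 1; ring
    _ ≤ _ := this
    _ = _ := by ring

/-- Near `t` the signal is close to a superposition of pure frequencies. -/
lemma SlowlyVarying.norm_signal_sub_le (h : SlowlyVarying A φ t α Δ) (hα : 0 ≤ α) {u : ℝ}
    (hu : |u| ≤ Δ) :
    ‖signal A φ (t + u) - ∑ j, A j t * Complex.exp (Complex.I * φ j t) *
      Complex.exp (Complex.I * ((deriv (φ j) t * u : ℝ) : ℂ))‖ ≤
      α * |u| * (sumAmp A t * (maxFreq φ t * Δ + 1)) := by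
  rw [signal, ← Finset.sum_sub_distrib, sumAmp, Finset.sum_mul, Finset.mul_sum]
  refine norm_sum_le_of_le _ fun j _ => ?_
  set d := deriv (φ j) t
  set ψ := φ j (t + u) - (φ j t + d * u) with hψ
  have hexp : Complex.exp (Complex.I * φ j (t + u)) = Complex.exp (Complex.I * φ j t) *
      Complex.exp (Complex.I * ((d * u : ℝ) : ℂ)) * Complex.exp (Complex.I * ψ) := by
    rw [← Complex.exp_add, ← Complex.exp_add, hψ]
    congr 1
    push_cast
    ring
  have hid : A j (t + u) * Complex.exp (Complex.I * φ j (t + u)) -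
      A j t * Complex.exp (Complex.I * φ j t) * Complex.exp (Complex.I * ((d * u : ℝ) : ℂ)) =
      (A j (t + u) - A j t) * Complex.exp (Complex.I * φ j (t + u)) +
      (Complex.exp (Complex.I * ψ) - 1) * A j t * Complex.exp (Complex.I * φ j t) *
        Complex.exp (Complex.I * ((d * u : ℝ) : ℂ)) := by
    rw [hexp]
    ring
  rw [hid]
  refine (norm_add_le _ _).trans ?_
  rw [norm_mul_exp_I, norm_mul_exp_I, norm_mul_exp_I, norm_mul]
  have h1 := h.amp j u hu
  have h2 : ‖Complex.exp (Complex.I * ψ) - 1‖ ≤ α * |u| * (maxFreq φ t * Δ) := by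
    refine norm_exp_I_mul_ofReal_sub_one_le.trans ((h.abs_phase_sub_le hα j hu).trans ?_)
    have hd : |d| ≤ maxFreq φ t := abs_deriv_le_maxFreq j
    have := (abs_nonneg d).trans hd
    -- One factor `|u|` is traded for `Δ`, so the error is linear in `|u|` and the first moment of
    -- the weights applies.
    calc α * |u| ^ 2 * |d| = α * |u| * (|d| * |u|) := by ring
      _ ≤ α * |u| * (maxFreq φ t * Δ) := by gcongr
  calc _ ≤ α * |u| * ‖A j t‖ + α * |u| * (maxFreq φ t * Δ) * ‖A j t‖ := by gcongr
    _ = _ := by ring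

/-- Sampling a pure frequency at step `-1/R` yields `e^{-iℓλ_j}`, which translates the kernel to
`λ_j`. -/
lemma sigma_sum_exp (H : ℝ → ℝ) (n : ℕ) (R : ℝ) (c : Fin K → ℂ) (x : Torus) :
    sigma H n (fun ℓ => ∑ j, c j *
      Complex.exp (Complex.I * ((deriv (φ j) t * -(ℓ / R) : ℝ) : ℂ))) x =
      ∑ j, c j * kernel H n (x - freq φ t R j) := by
  simp only [kernel, sigma_eq_sum_weight, Finset.mul_sum, Finset.sum_mul]
  rw [Finset.sum_comm]
  refine Finset.sum_congr rfl fun j _ => Finset.sum_congr rfl fun ℓ _ => ?_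
  have : Complex.exp (Complex.I * ((deriv (φ j) t * -(ℓ / R) : ℝ) : ℂ)) =
      fourier (-ℓ) (freq φ t R j) := by
    rw [freq, fourier_coe_eq_exp]
    congr 3
    push_cast
    ring
  rw [fourier_sub_apply, this]
  ring

lemma thresholdC_spec {S L : ℝ} (hK : 1 ≤ K) (hA : ∀ j, A j t ≠ 0) (hS : 2 ≤ S) (hL : 1 ≤ L) :
    1 ≤ thresholdC A φ t S L ∧
      thresholdC A φ t S L ^ S = 16 * sumAmp A t * L / minAmp A φ t := by
  have hm := minAmp_pos (φ := φ) hK hA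
  have hM := minAmp_le_sumAmp (A := A) (φ := φ) (t := t) hK
  have hbase : 1 ≤ 16 * sumAmp A t * L / minAmp A φ t := by
    rw [le_div_iff₀ hm]
    nlinarith
  refine ⟨one_le_rpow hbase (by positivity), ?_⟩
  rw [thresholdC, ← rpow_mul (by linarith), one_div_mul_cancel (by linarith), rpow_one]

/-- `C` is the solution of `M L / C^S = m/16`, and `r^S ≥ r²` as `S ≥ 2`. The cases `r = 1` and `r =
3` give the bounds `m/16` and `m/144`. -/
lemma sumAmp_mul_norm_kernel_le {H : ℝ → ℝ} {n : ℕ} {S L r : ℝ} (hn : 0 < n) (hK : 1 ≤ K)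
    (hA : ∀ j, A j t ≠ 0) (hS : 2 ≤ S) (hL : IsLocConst H S L) (hr : 1 ≤ r) {y : Torus}
    (hy : r * thresholdC A φ t S L / n ≤ ‖y‖) :
    sumAmp A t * ‖kernel H n y‖ ≤ minAmp A φ t / (16 * r ^ 2) := by
  have hn' : (0 : ℝ) < n := by exact_mod_cast hn
  obtain ⟨hC1, hCS⟩ := thresholdC_spec (φ := φ) hK hA hS hL.1
  have hm := minAmp_pos (φ := φ) hK hA
  have hM := hm.trans_le (minAmp_le_sumAmp hK)
  have hL0 : 0 < L := one_pos.trans_le hL.1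
  set C := thresholdC A φ t S L
  rw [div_le_iff₀ hn', mul_comm ‖y‖] at hy
  have hpow : r ^ 2 * (16 * sumAmp A t * L / minAmp A φ t) ≤ (n * ‖y‖) ^ S := by
    calc _ ≤ r ^ S * C ^ S := by
          rw [hCS]
          refine mul_le_mul_of_nonneg_right ?_ (by positivity)
          rw [← rpow_two]
          exact rpow_le_rpow_of_exponent_le hr hS
      _ = (r * C) ^ S := (mul_rpow (by linarith) (by linarith)).symm
      _ ≤ _ := rpow_le_rpow (by positivity) hy (by linarith)
  calc sumAmp A t * ‖kernel H n y‖
      ≤ sumAmp A t * (L / (r ^ 2 * (16 * sumAmp A t * L / minAmp A φ t))) := by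
        refine mul_le_mul_of_nonneg_left ((hL.2 n hn y).trans ?_) hM.le
        exact div_le_div_of_nonneg_left hL0.le (by positivity) (hpow.trans (le_max_right _ _))
    _ = _ := by field_simp

theorem separates_of_noise_le {H : ℝ → ℝ} (hH : IsLowPass H) {n : ℕ} (hn : 0 < n) {R S L : ℝ}
    (hK : 1 ≤ K) (hR : 0 < R) (hα : 0 < α) (hS : 2 ≤ S) (hL : IsLocConst H S L)
    (hA : ∀ j, A j t ≠ 0) (h : SlowlyVarying A φ t α Δ) (hnR : n ≤ R * Δ)
    (hη : ENNReal.ofReal (4 * thresholdC A φ t S L) / minSep φ t R ≤ n)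
    (hsmall : α * sumAmp A t * (maxFreq φ t * Δ + 1) * Δ ≤ minAmp A φ t / 4)
    {ε : ℤ → ℂ} (hε : ∀ x, ‖sigma H n ε x‖ ≤ minAmp A φ t / 16) :
    Separates (fun x => sigma H n (fun ℓ => signal A φ (t - ℓ / R) + ε ℓ) x)
      (3 * minAmp A φ t / 4) (thresholdC A φ t S L) n (minSep φ t R) (freq φ t R) := by
  have hn' : (0 : ℝ) < n := by exact_mod_cast hn
  have hm := minAmp_pos (φ := φ) hK hA
  obtain ⟨hC1, -⟩ := thresholdC_spec (φ := φ) hK hA hS hL.1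
  have hM := hm.trans_le (minAmp_le_sumAmp hK)
  have hnΔ : n / R ≤ Δ := by rwa [div_le_iff₀ hR, mul_comm]
  have hΔ : 0 < Δ := (div_pos hn' hR).trans_le hnΔ
  have hB : 0 ≤ maxFreq φ t := (abs_nonneg _).trans (abs_deriv_le_maxFreq ⟨0, hK⟩)
  set c : Fin K → ℂ := fun j => A j t * Complex.exp (Complex.I * φ j t) with hc
  have hcn : ∀ j, ‖c j‖ = ‖A j t‖ := fun j => norm_mul_exp_I _ _
  have hcs : ∑ j, ‖c j‖ = sumAmp A t := by simp only [hcn, sumAmp]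
  have hη' : ∀ ℓ k, ℓ ≠ k → minSep φ t R ≤ edist (freq φ t R ℓ) (freq φ t R k) :=
    fun ℓ k hne => (iInf_le _ ℓ).trans ((iInf_le _ k).trans (iInf_le _ hne))
  -- The quotient in `hη` is taken in `[0, ∞]`: it is 0 for infinite separation and `∞` for
  -- coinciding frequencies, which are thereby excluded.
  have hsep : ∀ ℓ k, ℓ ≠ k →
      4 * thresholdC A φ t S L / n ≤ dist (freq φ t R ℓ) (freq φ t R k) := by
    intro ℓ k hne
    have h1 : ENNReal.ofReal (4 * thresholdC A φ t S L) ≤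
        n * edist (freq φ t R ℓ) (freq φ t R k) :=
      ((ENNReal.div_le_iff_le_mul (.inr (ENNReal.natCast_ne_top n))
        (.inr (by exact_mod_cast hn.ne'))).1 hη).trans
        (mul_le_mul_right (hη' ℓ k hne) _)
    rw [edist_dist, ← ENNReal.ofReal_natCast, ← ENNReal.ofReal_mul hn'.le,
      ENNReal.ofReal_le_ofReal_iff (by positivity)] at h1
    rwa [div_le_iff₀' hn']
  refine separates_of_norm_sub_le (Φ := kernel H n) (c := c) hn (continuous_sigma H n _) hm
    (fun j => by rw [hcn]; exact minAmp_le j) hC1 (fun y => hH.le_norm_kernel hn)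
    (fun y hy => ?_) (fun y hy => ?_) hη' hsep fun x => ?_
  · rw [hcs]
    refine (sumAmp_mul_norm_kernel_le hn hK hA hS hL le_rfl (by rwa [one_mul])).trans_eq ?_
    norm_num
  · rw [hcs]
    refine (sumAmp_mul_norm_kernel_le hn hK hA hS hL (by norm_num) hy).trans_eq ?_
    norm_num
  · have hsig : ‖sigma H n (fun ℓ => signal A φ (t - ℓ / R) - ∑ j, c j *
        Complex.exp (Complex.I * ((deriv (φ j) t * -(ℓ / R) : ℝ) : ℂ))) x‖ ≤
        minAmp A φ t / 8 := by
      set Q := α * (sumAmp A t * (maxFreq φ t * Δ + 1)) with hQ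
      have hQ0 : 0 ≤ Q := by positivity
      calc _ ≤ ∑ ℓ ∈ Finset.Ioo (-(n : ℤ)) (n : ℤ), weight H n ℓ * ‖signal A φ (t - ℓ / R) -
            ∑ j, c j * Complex.exp (Complex.I * ((deriv (φ j) t * -(ℓ / R) : ℝ) : ℂ))‖ :=
            hH.norm_sigma_le hn _ x
        _ ≤ ∑ ℓ ∈ Finset.Ioo (-(n : ℤ)) (n : ℤ), weight H n ℓ * |(ℓ : ℝ)| * (Q / R) := by
            refine Finset.sum_le_sum fun ℓ hℓ => ?_
            rw [mul_assoc]
            refine mul_le_mul_of_nonneg_left ?_ (hH.weight_nonneg hn ℓ)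
            rw [Finset.mem_Ioo, ← abs_lt] at hℓ
            have hℓ' : |(ℓ : ℝ)| ≤ n := by exact_mod_cast hℓ.le
            have habs : |-((ℓ : ℝ) / R)| = |(ℓ : ℝ)| / R := by
              rw [abs_neg, abs_div, abs_of_pos hR]
            have := h.norm_signal_sub_le hα.le (u := -((ℓ : ℝ) / R))
              (by rw [habs]; exact (div_le_div_of_nonneg_right hℓ' hR.le).trans hnΔ)
            rw [← sub_eq_add_neg, habs] at this
            refine this.trans_eq ?_
            rw [hQ]
            ring
        -- With `n/R ≤ Δ` and `QΔ ≤ m/4`, the moment bound halves the error to `m/8`; bounding `|ℓ|`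
        -- by `n` would exceed the budget `3m/16`.
        _ ≤ n / 2 * (Q / R) := by
            rw [← Finset.sum_mul]
            exact mul_le_mul_of_nonneg_right (hH.sum_weight_mul_abs_le hn) (by positivity)
        _ = Q * (n / R) / 2 := by ring
        _ ≤ Q * Δ / 2 := by gcongr
        _ ≤ minAmp A φ t / 8 := by rw [hQ]; linarith
    rw [sigma_sub, sigma_sum_exp] at hsig
    rw [sigma_add, add_sub_right_comm]
    refine (norm_add_le _ _).trans ?_
    linarith [hε x]

end Signal

end SSO

end

/-! ### Assembly of the theorem -/

theorem theorem3p3 (H : ℝ → ℝ) (hH : SSO.IsLowPass H) :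
    (ContDiff ℝ (⊤ : ℕ∞) H → ∀ S : ℝ, 2 ≤ S → ∃ L : ℝ, SSO.IsLocConst H S L) ∧
    ∃ C₁ C₂ C₃ : ℝ, 1 ≤ C₁ ∧ 0 < C₂ ∧ 0 < C₃ ∧
      (∀ (Ω : Type*) [MeasurableSpace Ω] (P : MeasureTheory.Measure Ω)
        [MeasureTheory.IsProbabilityMeasure P] (V δ : ℝ) (n : ℕ) (e : ℤ → Ω → ℂ),
        0 < V → 0 < δ → δ < 1 → C₁ ≤ n → SSO.IsNoise P V n e →
        P.real {ω | ∃ x : SSO.Torus,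
          SSO.noiseLevel C₂ C₃ V δ n ≤ ‖SSO.sigma H n (fun ℓ => e ℓ ω) x‖} ≤ δ) ∧
      (∀ (Ω : Type*) [MeasurableSpace Ω] (P : MeasureTheory.Measure Ω)
        [MeasureTheory.IsProbabilityMeasure P] (K n : ℕ) (A : Fin K → ℝ → ℂ)
        (φ : Fin K → ℝ → ℝ) (ε : ℝ → Ω → ℂ) (t R Δ α V δ S L : ℝ),
        1 ≤ K → 0 < R → 0 < Δ → 0 < α → 0 < V → 0 < δ → δ < 1 → 2 ≤ S →
        SSO.IsLocConst H S L →
        (∀ j, A j t ≠ 0) →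
        SSO.SlowlyVarying A φ t α Δ →
        n = ⌊R * Δ⌋₊ →
        SSO.IsNoise P V n (fun ℓ => ε (t - ℓ / R)) →
        C₁ ≤ n →
        SSO.noiseLevel C₂ C₃ V δ n ≤ SSO.minAmp A φ t / 16 →
        ENNReal.ofReal (4 * SSO.thresholdC A φ t S L) / SSO.minSep φ t R ≤ n →
        α * SSO.sumAmp A t * (SSO.maxFreq φ t * Δ + 1) * Δ ≤ SSO.minAmp A φ t / 4 →
        ∃ E : Set Ω, MeasurableSet E ∧ 1 - δ < P.real E ∧ ∀ ω ∈ E,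
          SSO.Separates (SSO.sso H n R (fun s => SSO.signal A φ s + ε s ω) t)
            (3 * SSO.minAmp A φ t / 4) (SSO.thresholdC A φ t S L) n
            (SSO.minSep φ t R) (SSO.freq φ t R)) := by
  refine ⟨fun hs S hS => hH.exists_isLocConst hs (by linarith), 1, 16, 20, le_rfl, by norm_num,
    by norm_num, ?_, ?_⟩
  · intro Ω _ P _ V δ n e hV hδ hδ1 hn he
    have hn0 : 0 < n := by exact_mod_cast hn
    exact (he.measureReal_exists_le_norm_sigma_lt hH hn0 hV hδ hδ1).le
  · intro Ω _ P _ K n A φ ε t R Δ α V δ S L hK hR hΔ hα hV hδ hδ1 hS hL hA hsv hnR he hn hlevel hη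
      hsmall
    have hn0 : 0 < n := by exact_mod_cast hn
    have hbad := he.measureReal_exists_le_norm_sigma_lt hH hn0 hV hδ hδ1
    set bad := {ω | ∃ x, SSO.noiseLevel 16 20 V δ n ≤
      ‖SSO.sigma H n (fun ℓ => ε (t - ℓ / R) ω) x‖}
    -- The measurable hull has the same measure as `bad`, so measurability of `bad` is not needed;
    -- the strict noise bound gives the strict inequality for the complement.
    have hmeas := MeasureTheory.measurableSet_toMeasurable P bad
    refine ⟨(MeasureTheory.toMeasurable P bad)ᶜ, hmeas.compl, ?_, fun ω hω => ?_⟩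
    · rw [MeasureTheory.probReal_compl_eq_one_sub hmeas, MeasureTheory.measureReal_def,
        MeasureTheory.measure_toMeasurable, ← MeasureTheory.measureReal_def]
      linarith
    · have hω' : ∀ x, ‖SSO.sigma H n (fun ℓ => ε (t - ℓ / R) ω) x‖ ≤ SSO.minAmp A φ t / 16 := by
        intro x
        by_contra! hx
        exact hω (MeasureTheory.subset_toMeasurable P bad ⟨x, hlevel.trans hx.le⟩)
      exact SSO.separates_of_noise_le hH hn0 hK hR hα hS hL hA hsv
        (hnR ▸ Nat.floor_le (by positivity)) hη hsmall hω'
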